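/- There is an absolute constant $C>0$ such that the following holds for all positive integers $k$ and $n$. Call a collection $\{X_i\}_{i=1}^n$ of independent $\{0,1\}$-valued random variables *in $k$-heavy Binomial form* if there are $\ell\in\{0,1,\dots,n\}$ and $q\in\left\{\frac{1}{kn},\frac{2}{kn},\dots,\frac{kn-1}{kn}\right\}$ such that $\mathbf{E}[X_i]=q$ for all $i\le \ell$, $\mathbf{E}[X_i]\in\{0,1\}$ for all $i>\ell$, and $$\ell q\ \ge\ k^2-\frac1k,\qquad \ell q(1-q)\ \ge\ k^2-k-1-\frac3k .$$ Let $\{X_i\}_{i=1}^n$ and $\{Y_i\}_{i=1}^n$ be two such collections, both in $k$-heavy Binomial form (with possibly different $\ell$ and $q$), and put $X=\sum_{i=1}^n X_i$, $Y=\sum_{i=1}^n Y_i$. Then $$\tfrac12\, d_{\mathrm K}(X,Y)\ \le\ d_{\mathrm{TV}}(X,Y)\ \le\ 2\,d_{\mathrm K}(X,Y)+\frac{C}{k},$$ where $d_{\mathrm{TV}}(X,Y)=\frac12\sum_{a}|\Pr[X=a]-\Pr[Y=a]|$ is the total variation distance and $d_{\mathrm K}(X,Y)=\sup_{x\in\mathbb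 R}|\Pr[X\le x]-\Pr[Y\le x]|$ is the Kolmogorov distance. -/

import Mathlib

open MeasureTheory ProbabilityTheory

namespace PoissonBinomial

noncomputable section

/-- Total variation distance `(1/2) ∑ₐ |P(a) - Q(a)|` of two distributions on a countable
discrete domain. -/
def tvDist {α : Type*} [MeasurableSpace α] [MeasurableSingletonClass α] [Countable α]
    (P Q : Measure α) : ℝ :=
  (1 / 2 : ℝ) * ∑' a : α, |P.real {a} - Q.real {a}|

/-- Kolmogorov distance `sup_x |P((-∞, x]) - Q((-∞, x])|` of two distributions on `ℝ`. -/
def kolmogorovDist (P Q : Measure ℝ) : ℝ :=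
  ⨆ x : ℝ, |P.real (Set.Iic x) - Q.real (Set.Iic x)|

/-- Total variation distance of two `ℕ`-valued random variables, possibly defined on
different probability spaces: the distance between their laws. -/
def dTV {Ω Ω' : Type*} [MeasurableSpace Ω] [MeasurableSpace Ω'] (μ : Measure Ω) (X : Ω → ℕ)
    (ν : Measure Ω') (Y : Ω' → ℕ) : ℝ :=
  tvDist (μ.map X) (ν.map Y)

/-- Kolmogorov distance of two `ℕ`-valued random variables, regarded as real-valued: the
distance between their laws. -/
def dK {Ω Ω' : Type*} [MeasurableSpace Ω] [MeasurableSpace Ω'] (μ : Measure Ω) (X : Ω → ℕ)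
    (ν : Measure Ω') (Y : Ω' → ℕ) : ℝ :=
  kolmogorovDist (μ.map fun ω => (X ω : ℝ)) (ν.map fun ω => (Y ω : ℝ))

/-- `X₁, …, Xₙ` are independent `{0,1}`-valued random variables. -/
structure IndependentIndicators {Ω : Type*} [MeasurableSpace Ω] (μ : Measure Ω) {n : ℕ}
    (X : Fin n → Ω → ℕ) : Prop where
  measurable : ∀ i, Measurable (X i)
  zero_or_one : ∀ i ω, X i ω = 0 ∨ X i ω = 1
  indep : iIndepFun X μ

/-- The `k`-heavy Binomial form, as a condition on the vector `p` of means: for some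
`ℓ ∈ {0, …, n}` and `q ∈ {1/(kn), …, (kn-1)/(kn)}`, the first `ℓ` means are `q`, the others are
`0` or `1`, and `ℓ q ≥ k² - 1/k`, `ℓ q (1 - q) ≥ k² - k - 1 - 3/k`.
(The index `i : Fin n` stands for the index `i + 1` of `1, …, n`.) -/
def IsHeavyBinomialForm (k : ℕ) {n : ℕ} (p : Fin n → ℝ) : Prop :=
  ∃ (ℓ : ℕ) (q : ℝ), ℓ ≤ n ∧
    (∃ j : ℕ, 1 ≤ j ∧ j < k * n ∧ q = (j : ℝ) / ((k : ℝ) * (n : ℝ))) ∧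
    (∀ i : Fin n, (i : ℕ) < ℓ → p i = q) ∧
    (∀ i : Fin n, ℓ ≤ (i : ℕ) → p i = 0 ∨ p i = 1) ∧
    (k : ℝ) ^ 2 - 1 / (k : ℝ) ≤ (ℓ : ℝ) * q ∧
    (k : ℝ) ^ 2 - (k : ℝ) - 1 - 3 / (k : ℝ) ≤ (ℓ : ℝ) * q * (1 - q)

/-- A collection of independent indicators in `k`-heavy Binomial form. -/
structure HeavyBinomialCollection {Ω : Type*} [MeasurableSpace Ω] (μ : Measure Ω) (k : ℕ) {n : ℕ}
    (X : Fin n → Ω → ℕ) : Prop where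
  indicators : IndependentIndicators μ X
  heavy : IsHeavyBinomialForm k fun i => ∫ ω, (X i ω : ℝ) ∂μ

end

end PoissonBinomial

/-! The lower bound is crude: the discrepancy on any event is at most the `ℓ¹` distance of the
weights, which is twice the total variation distance.

For the upper bound, the total variation distance is attained on the set where one weight exceeds
the other. If that set is an interval, it is a difference of two lower sets, so its discrepancy is
at most twice the Kolmogorov distance. For two translated Poisson laws the set is an interval, once
the law with the larger shift is put on the larger side (`translatedPoisson_ordConnected_setOf_lt`).

It remains to replace each sum by a translated Poisson law at cost `O(1/k)`. Let `m` and `v` be the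
mean and variance of the sum, `s = ⌊m - v⌋` and `lam = m - s`, so that the Poisson variance `lam` is
within `1` of `v`. Stein's method compares the Poisson equation (`steinSolution_eq`), whose solution
has increments at most `1 / lam`, with a Stein identity for the sum (`integral_sum_sub_mul`). The
latter has a simple remainder because all nondegenerate means equal one `q`. The error is `1 / √v +
3 / v` (`abs_integral_sub_tsum_le`), and `v` is of order `k²`. -/

namespace PoissonBinomial

/-! ### The Stein equation of the Poisson distribution -/

/-- The recursion that characterizes the Poisson weights with mean `lam`. -/
structure IsPoissonWeight (lam : ℝ) (w : ℕ → ℝ) : Prop where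
  mean_pos : 0 < lam
  pos : ∀ j, 0 < w j
  hasSum : HasSum w 1
  succ : ∀ j : ℕ, ((j : ℝ) + 1) * w (j + 1) = lam * w j

theorem isPoissonWeight_poissonMeasure {r : NNReal} (hr : 0 < r) :
    IsPoissonWeight r fun j => (poissonMeasure r).real {j} where
  mean_pos := by exact_mod_cast hr
  pos j := by
    have : (0 : ℝ) < r := by exact_mod_cast hr
    rw [poissonMeasure_real_singleton]
    positivity
  hasSum := by simpa only [poissonMeasure_real_singleton] using hasSum_one_poissonMeasure r
  succ j := by
    simp only [poissonMeasure_real_singleton, Nat.factorial_succ, pow_succ]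
    push_cast
    field_simp

/-- The solution of the Stein equation for the test function `f` and the weights `w`, with the
value at `0` chosen to be that at `1`. -/
noncomputable def steinSolution (lam : ℝ) (w f : ℕ → ℝ) (a : ℕ) : ℝ :=
  (∑ j ∈ Finset.range (a - 1 + 1), (f j - ∑' i, w i * f i) * w j) / (lam * w (a - 1))

namespace IsPoissonWeight

variable {lam : ℝ} {w : ℕ → ℝ} (hw : IsPoissonWeight lam w)
include hw

theorem summable_mul {f : ℕ → ℝ} (hf : ∀ j, f j ∈ Set.Icc (0 : ℝ) 1) :
    Summable fun j => w j * f j :=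
  hw.hasSum.summable.of_nonneg_of_le (fun j => mul_nonneg (hw.pos j).le (hf j).1)
    fun j => mul_le_of_le_one_right (hw.pos j).le (hf j).2

theorem tsum_mem {f : ℕ → ℝ} (hf : ∀ j, f j ∈ Set.Icc (0 : ℝ) 1) :
    ∑' j, w j * f j ∈ Set.Icc (0 : ℝ) 1 := by
  refine ⟨tsum_nonneg fun j => mul_nonneg (hw.pos j).le (hf j).1, ?_⟩
  rw [← hw.hasSum.tsum_eq]
  exact (hw.summable_mul hf).tsum_le_tsum
    (fun j => mul_le_of_le_one_right (hw.pos j).le (hf j).2) hw.hasSum.summable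

theorem tsum_one_sub {f : ℕ → ℝ} (hf : ∀ j, f j ∈ Set.Icc (0 : ℝ) 1) :
    ∑' j, w j * (1 - f j) = 1 - ∑' j, w j * f j := by
  rw [← (hw.hasSum.sub (hw.summable_mul hf).hasSum).tsum_eq]
  exact tsum_congr fun j => by ring

theorem steinSolution_one_sub {f : ℕ → ℝ} (hf : ∀ j, f j ∈ Set.Icc (0 : ℝ) 1) (a : ℕ) :
    steinSolution lam w (fun j => 1 - f j) a = -steinSolution lam w f a := by
  simp only [steinSolution, hw.tsum_one_sub hf]
  rw [← neg_div, ← Finset.sum_neg_distrib]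
  congr 1
  exact Finset.sum_congr rfl fun j _ => by ring

theorem steinSolution_one (f : ℕ → ℝ) :
    lam * steinSolution lam w f 1 = f 0 - ∑' j, w j * f j := by
  have h1 := hw.mean_pos.ne'
  have h2 := (hw.pos 0).ne'
  simp only [steinSolution]
  norm_num
  field_simp

theorem steinSolution_eq (f : ℕ → ℝ) (a : ℕ) :
    lam * steinSolution lam w f (a + 1) - a * steinSolution lam w f a =
      f a - ∑' j, w j * f j := by
  cases a with
  | zero => simpa using hw.steinSolution_one f
  | succ v =>
    have h1 := hw.mean_pos.ne'
    have h2 := (hw.pos v).ne'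
    have h3 := (hw.pos (v + 1)).ne'
    have h4 := hw.succ v
    simp only [steinSolution, Nat.add_sub_cancel]
    rw [Finset.sum_range_succ _ (v + 1)]
    generalize ∑ j ∈ Finset.range (v + 1), (f j - ∑' i, w i * f i) * w j = S
    rw [← h4]
    push_cast
    field_simp
    ring

theorem abs_steinSolution_one_le {f : ℕ → ℝ} (hf : ∀ j, f j ∈ Set.Icc (0 : ℝ) 1) :
    |steinSolution lam w f 1| ≤ 1 / lam := by
  have h := hw.steinSolution_one f
  have h0 := hf 0
  have h1 := hw.tsum_mem hf
  rw [le_div_iff₀ hw.mean_pos, mul_comm, ← abs_of_pos hw.mean_pos, ← abs_mul,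
    abs_of_pos hw.mean_pos, h, abs_le]
  constructor <;> linarith [h0.1, h0.2, h1.1, h1.2]

/-- The increment is affine in `A`, `T` and `f (v + 1)`, the contributions of `f` below, above and
at `v + 1`. By the weight recursion, `hG1` and `hF1` make the coefficients of `A` and `T`
nonpositive, so only the contribution at `v + 1` can be positive. -/
theorem steinSolution_sub_le {f : ℕ → ℝ} (hf : ∀ j, f j ∈ Set.Icc (0 : ℝ) 1) (v : ℕ) :
    steinSolution lam w f (v + 2) - steinSolution lam w f (v + 1) ≤ 1 / lam := by
  have hl := hw.mean_pos
  have ha := hw.pos v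
  have hb := hw.pos (v + 1)
  have hab := hw.succ v
  set A := ∑ j ∈ Finset.range (v + 1), w j * f j with hA
  set F := ∑ j ∈ Finset.range (v + 1), w j with hF
  set T := ∑' j, w (j + (v + 2)) * f (j + (v + 2)) with hT
  set G := ∑' j, w (j + (v + 2)) with hG
  have hφ := hf (v + 1)
  have hsf : A + w (v + 1) * f (v + 1) + T = ∑' j, w j * f j := by
    rw [hA, ← Finset.sum_range_succ]
    exact (hw.summable_mul hf).sum_add_tsum_nat_add (v + 2)
  have hs1 : F + w (v + 1) + G = 1 := by
    rw [hF, ← Finset.sum_range_succ, ← hw.hasSum.tsum_eq]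
    exact hw.hasSum.summable.sum_add_tsum_nat_add (v + 2)
  have hA0 : 0 ≤ A := Finset.sum_nonneg fun j _ => mul_nonneg (hw.pos j).le (hf j).1
  have hT0 : 0 ≤ T := tsum_nonneg fun j => mul_nonneg (hw.pos _).le (hf _).1
  have hv : (0 : ℝ) < v + 1 := by positivity
  -- `lam * F ≤ (v + 1) * (F + w (v + 1))`
  have hF1 : lam * F ≤ (v + 1) * (F + w (v + 1)) := by
    have h : ∑ j ∈ Finset.range (v + 1), w (j + 1) ≤ F + w (v + 1) := by
      rw [hF, ← Finset.sum_range_succ, Finset.sum_range_succ' _ (v + 1)]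
      linarith [hw.pos 0]
    refine le_trans ?_ (mul_le_mul_of_nonneg_left h hv.le)
    rw [hF, Finset.mul_sum, Finset.mul_sum]
    refine Finset.sum_le_sum fun j hj => ?_
    rw [← hw.succ j]
    have : (j : ℝ) ≤ v := by exact_mod_cast Nat.lt_succ_iff.mp (Finset.mem_range.mp hj)
    exact mul_le_mul_of_nonneg_right (by linarith) (hw.pos _).le
  have hG1 : (v + 1) * G ≤ lam * (w (v + 1) + G) := by
    have hs : Summable fun j => w (j + (v + 1)) :=
      (summable_nat_add_iff (v + 1)).mpr hw.hasSum.summable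
    have hs' : Summable fun j => w (j + (v + 2)) :=
      (summable_nat_add_iff (v + 2)).mpr hw.hasSum.summable
    have h : w (v + 1) + G = ∑' j, w (j + (v + 1)) := by
      rw [hs.tsum_eq_zero_add, zero_add]
      congr 1
      exact tsum_congr fun j => by congr 1; ring
    rw [h, hG, ← tsum_mul_left, ← tsum_mul_left]
    refine (hs'.mul_left _).tsum_le_tsum (fun j => ?_) (hs.mul_left _)
    rw [← hw.succ (j + (v + 1))]
    push_cast
    exact mul_le_mul_of_nonneg_right (by linarith [j.cast_nonneg (α := ℝ)]) (hw.pos _).le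
  have e1 : steinSolution lam w f (v + 1) =
      (A - (A + w (v + 1) * f (v + 1) + T) * F) / (lam * w v) := by
    simp only [steinSolution, Nat.add_sub_cancel, ← hsf, sub_mul, Finset.sum_sub_distrib,
      ← Finset.mul_sum, ← hF]
    rw [hA]
    simp only [mul_comm]
  have e2 : steinSolution lam w f (v + 2) =
      (A + w (v + 1) * f (v + 1) - (A + w (v + 1) * f (v + 1) + T) * (F + w (v + 1))) /
        (lam * w (v + 1)) := by
    have e : v + 2 - 1 = v + 1 := rfl
    simp only [steinSolution, e, ← hsf, sub_mul, Finset.sum_sub_distrib, ← Finset.mul_sum,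
      Finset.sum_range_succ _ (v + 1), ← hF]
    rw [hA]
    simp only [mul_comm]
    ring
  rw [e1, e2, ← hab]
  clear_value A F T G
  generalize w (v + 1) = b at *
  generalize f (v + 1) = t at *
  have hG2 : G = 1 - F - b := by linarith
  have key : (A + b * t - (A + b * t + T) * (F + b)) * (v + 1) -
      lam * (A - (A + b * t + T) * F) ≤ b * (v + 1) := by
    have i1 := mul_nonneg hA0 (sub_nonneg.mpr hG1)
    have i2 := mul_nonneg hT0 (sub_nonneg.mpr hF1)
    have i3 := mul_nonneg (mul_nonneg hb.le hφ.1) (sub_nonneg.mpr hF1)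
    have i4 := mul_nonneg (mul_nonneg hb.le (sub_nonneg.mpr hφ.2)) hv.le
    subst hG2
    nlinarith [i1, i2, i3, i4]
  have e3 : (A + b * t - (A + b * t + T) * (F + b)) / (lam * b) -
      (A - (A + b * t + T) * F) / ((v + 1) * b) =
      ((A + b * t - (A + b * t + T) * (F + b)) * (v + 1) - lam * (A - (A + b * t + T) * F)) /
        (lam * (b * (v + 1))) := by
    field_simp
  rw [e3, div_le_div_iff₀ (by positivity) hl]
  nlinarith [mul_le_mul_of_nonneg_left key hl.le]

theorem abs_steinSolution_sub_le {f : ℕ → ℝ} (hf : ∀ j, f j ∈ Set.Icc (0 : ℝ) 1) (a : ℕ) :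
    |steinSolution lam w f (a + 1) - steinSolution lam w f a| ≤ 1 / lam := by
  cases a with
  | zero =>
    -- Truncated subtraction gives `0 - 1 = 1 - 1`, so the first increment vanishes.
    have h : steinSolution lam w f 1 = steinSolution lam w f 0 := rfl
    simpa [h] using hw.mean_pos.le
  | succ v =>
    rw [abs_le]
    refine ⟨?_, hw.steinSolution_sub_le hf v⟩
    -- Passing to `1 - f` negates the solution, so the upper bound also yields the lower one.
    have h := hw.steinSolution_sub_le (f := fun j => 1 - f j)
      (fun j => ⟨by linarith [(hf j).2], by linarith [(hf j).1]⟩) v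
    rw [hw.steinSolution_one_sub hf, hw.steinSolution_one_sub hf] at h
    linarith

end IsPoissonWeight

/-! ### Total variation and Kolmogorov distance of laws on `ℕ` -/

/-- The Kolmogorov distance of two laws on `ℕ`, regarded as laws on `ℝ`. -/
noncomputable def natKolmogorovDist (P Q : Measure ℕ) : ℝ :=
  kolmogorovDist (P.map fun a : ℕ => (a : ℝ)) (Q.map fun a : ℕ => (a : ℝ))

theorem natKolmogorovDist_eq (P Q : Measure ℕ) :
    natKolmogorovDist P Q =
      ⨆ x : ℝ, |P.real {a : ℕ | (a : ℝ) ≤ x} - Q.real {a : ℕ | (a : ℝ) ≤ x}| := by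
  unfold natKolmogorovDist kolmogorovDist
  congr 1
  ext x
  rw [map_measureReal_apply .of_discrete measurableSet_Iic,
    map_measureReal_apply .of_discrete measurableSet_Iic]
  rfl

theorem natKolmogorovDist_nonneg (P Q : Measure ℕ) : 0 ≤ natKolmogorovDist P Q :=
  Real.iSup_nonneg fun _ => abs_nonneg _

section Distances

variable (P Q : Measure ℕ) [IsProbabilityMeasure P] [IsProbabilityMeasure Q]

theorem hasSum_indicator_real_singleton (A : Set ℕ) :
    HasSum (A.indicator fun a => P.real {a}) (P.real A) := by
  have hs : Summable fun a => P.real {a} := by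
    refine ENNReal.summable_toReal ?_
    have h := P.tsum_indicator_apply_singleton Set.univ MeasurableSet.univ
    simp only [Set.indicator_univ] at h
    simp [h]
  have h := integral_countable (μ := P) (f := A.indicator 1)
    ((integrable_const (1 : ℝ)).indicator MeasurableSet.of_discrete)
  rw [integral_indicator_one MeasurableSet.of_discrete] at h
  rw [h]
  convert! (hs.indicator A).hasSum using 1
  refine tsum_congr fun a => ?_
  by_cases ha : a ∈ A <;> simp [ha]

theorem hasSum_indicator_sub (A : Set ℕ) :
    HasSum (A.indicator fun a => P.real {a} - Q.real {a}) (P.real A - Q.real A) := by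
  convert! (hasSum_indicator_real_singleton P A).sub (hasSum_indicator_real_singleton Q A) using 1
  exact Set.indicator_sub' A _ _

theorem summable_abs_sub : Summable fun a : ℕ => |P.real {a} - Q.real {a}| := by
  have h := (hasSum_indicator_sub P Q Set.univ).summable
  rw [Set.indicator_univ] at h
  exact h.abs

theorem abs_real_sub_le_tsum (A : Set ℕ) :
    |P.real A - Q.real A| ≤ ∑' a : ℕ, |P.real {a} - Q.real {a}| := by
  rw [← (hasSum_indicator_sub P Q A).tsum_eq]
  have hs := (hasSum_indicator_sub P Q A).summable
  have h := norm_tsum_le_tsum_norm (f := A.indicator fun a => P.real {a} - Q.real {a}) hs.norm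
  refine le_trans h (hs.norm.tsum_le_tsum (fun a => ?_) (summable_abs_sub P Q))
  exact norm_indicator_le_norm_self _ _

theorem tvDist_eq_real_sub :
    tvDist P Q = P.real {a | Q.real {a} < P.real {a}} - Q.real {a | Q.real {a} < P.real {a}} := by
  have h1 := hasSum_indicator_sub P Q {a | Q.real {a} < P.real {a}}
  have h2 := hasSum_indicator_sub P Q Set.univ
  rw [Set.indicator_univ, probReal_univ, probReal_univ, sub_self] at h2
  -- `|d| = 2 d⁺ - d`, and the differences `d` sum to zero.
  have h3 := ((h1.mul_left 2).sub h2).tsum_eq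
  unfold tvDist
  rw [sub_zero] at h3
  rw [show ∀ x y : ℝ, 1 / 2 * x = y ↔ x = 2 * y from fun x y => by constructor <;> intro <;> linarith,
    ← h3]
  refine tsum_congr fun a => ?_
  by_cases ha : Q.real {a} < P.real {a}
  · rw [Set.indicator_of_mem (by exact ha), abs_of_pos (sub_pos.mpr ha)]
    ring
  · rw [Set.indicator_of_notMem (by exact ha), abs_of_nonpos (sub_nonpos.mpr (not_lt.mp ha))]
    ring

theorem tvDist_le_one : tvDist P Q ≤ 1 := by
  rw [tvDist_eq_real_sub]
  linarith [measureReal_le_one (μ := P) (s := {a | Q.real {a} < P.real {a}}),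
    measureReal_nonneg (μ := Q) (s := {a | Q.real {a} < P.real {a}})]

/-- The set on which one weight exceeds the other is the most distinguishing one. -/
theorem real_sub_le_real_sub_setOf_lt (A : Set ℕ) :
    P.real A - Q.real A ≤
      P.real {a | Q.real {a} < P.real {a}} - Q.real {a | Q.real {a} < P.real {a}} := by
  refine hasSum_le (fun a => ?_) (hasSum_indicator_sub P Q A) (hasSum_indicator_sub P Q _)
  by_cases ha : Q.real {a} < P.real {a}
  · rw [Set.indicator_of_mem (s := {a | Q.real {a} < P.real {a}}) (by exact ha)]
    exact Set.indicator_le_self' (fun _ _ => (sub_pos.mpr ha).le) a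
  · rw [Set.indicator_of_notMem (s := {a | Q.real {a} < P.real {a}}) (by exact ha)]
    by_cases h : a ∈ A
    · rw [Set.indicator_of_mem h]
      exact sub_nonpos.mpr (not_lt.mp ha)
    · rw [Set.indicator_of_notMem h]

theorem half_natKolmogorovDist_le_tvDist : 1 / 2 * natKolmogorovDist P Q ≤ tvDist P Q := by
  unfold tvDist
  refine mul_le_mul_of_nonneg_left ?_ (by norm_num)
  rw [natKolmogorovDist_eq]
  exact Real.iSup_le (fun x => abs_real_sub_le_tsum P Q _) (tsum_nonneg fun _ => abs_nonneg _)

theorem abs_real_Iic_sub_le (b : ℕ) :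
    |P.real (Set.Iic b) - Q.real (Set.Iic b)| ≤ natKolmogorovDist P Q := by
  rw [natKolmogorovDist_eq]
  have h : BddAbove (Set.range fun x : ℝ =>
      |P.real {a : ℕ | (a : ℝ) ≤ x} - Q.real {a : ℕ | (a : ℝ) ≤ x}|) :=
    ⟨_, by rintro _ ⟨x, rfl⟩; exact abs_real_sub_le_tsum P Q _⟩
  refine le_trans (le_of_eq ?_) (le_ciSup h (b : ℝ))
  simp only [Nat.cast_le]
  rfl

theorem abs_real_sub_le_of_isLowerSet {L : Set ℕ} (hL : IsLowerSet L) :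
    |P.real L - Q.real L| ≤ natKolmogorovDist P Q := by
  rcases L.eq_empty_or_nonempty with rfl | hne
  · simpa using natKolmogorovDist_nonneg P Q
  by_cases hb : BddAbove L
  · have h : L = Set.Iic (sSup L) := by
      ext a
      exact ⟨fun ha => le_csSup hb ha, fun ha => hL ha (Nat.sSup_mem hne hb)⟩
    rw [h]
    exact abs_real_Iic_sub_le P Q _
  · have h : L = Set.univ := by
      refine Set.eq_univ_of_forall fun a => ?_
      obtain ⟨b, hb, hab⟩ := not_bddAbove_iff.mp hb a
      exact hL hab.le hb
    simpa [h] using natKolmogorovDist_nonneg P Q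

/-- With `L` the lower closure of `A`, both `L` and `L \ A` are lower sets; each contributes one
Kolmogorov distance. -/
theorem abs_real_sub_le_of_ordConnected {A : Set ℕ} (hA : A.OrdConnected) :
    |P.real A - Q.real A| ≤ 2 * natKolmogorovDist P Q := by
  set L : Set ℕ := ↑(lowerClosure A) with hLdef
  have hAL : A ⊆ L := subset_lowerClosure
  have hL : IsLowerSet L := (lowerClosure A).lower
  have hM : IsLowerSet (L \ A) := by
    intro a b hba ha
    refine ⟨hL hba ha.1, fun hb => ha.2 ?_⟩
    obtain ⟨c, hc, hac⟩ := mem_lowerClosure.mp ha.1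
    exact hA.out hb hc ⟨hba, hac⟩
  have hP := measureReal_sdiff (μ := P) hAL .of_discrete
  have hQ := measureReal_sdiff (μ := Q) hAL .of_discrete
  have h1 := abs_le.mp (abs_real_sub_le_of_isLowerSet P Q hL)
  have h2 := abs_le.mp (abs_real_sub_le_of_isLowerSet P Q hM)
  rw [hP, hQ] at h2
  rw [abs_le]
  constructor <;> linarith [h1.1, h1.2, h2.1, h2.2]

end Distances

/-! ### Sums of independent indicators -/

namespace IndependentIndicators

theorem measurable_sum {Ω : Type*} [MeasurableSpace Ω] {μ : Measure Ω} {n : ℕ} {X : Fin n → Ω → ℕ}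
    (hX : IndependentIndicators μ X) : Measurable fun ω => ∑ i, X i ω :=
  Finset.measurable_sum _ fun i _ => hX.measurable i

variable {Ω : Type*} [MeasurableSpace Ω] {μ : Measure Ω} [IsProbabilityMeasure μ] {n : ℕ}
  {X : Fin n → Ω → ℕ} (hX : IndependentIndicators μ X)
include hX

/-- The vector takes values in the finite set `{0,1}ⁿ`, so every function of it is bounded. -/
theorem integrable_comp (φ : (Fin n → ℕ) → ℝ) : Integrable (fun ω => φ fun i => X i ω) μ := by
  have hm : Measurable fun ω => (fun i => X i ω) := measurable_pi_lambda _ hX.measurable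
  refine Integrable.of_bound ((Measurable.of_discrete (f := φ)).comp hm).aestronglyMeasurable
    (∑ y ∈ Fintype.piFinset fun _ : Fin n => ({0, 1} : Finset ℕ), ‖φ y‖) (.of_forall fun ω => ?_)
  refine Finset.single_le_sum (f := fun y => ‖φ y‖) (fun _ _ => norm_nonneg _) ?_
  simpa [Fintype.mem_piFinset] using fun i => hX.zero_or_one i ω

theorem integrable_comp_sum (φ : ℕ → ℝ) : Integrable (fun ω => φ (∑ i, X i ω)) μ :=
  hX.integrable_comp fun y => φ (∑ i, y i)

theorem integral_mul_comp_erase (i : Fin n) (u : ℕ → ℝ) :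
    ∫ ω, (X i ω : ℝ) * u (∑ j ∈ Finset.univ.erase i, X j ω) ∂μ =
      (∫ ω, (X i ω : ℝ) ∂μ) * ∫ ω, u (∑ j ∈ Finset.univ.erase i, X j ω) ∂μ := by
  have h := (hX.indep.indepFun_finsetSum_of_notMem hX.measurable
    (Finset.notMem_erase i Finset.univ)).symm
  have h' := h.comp (φ := fun a : ℕ => (a : ℝ)) (ψ := u) .of_discrete .of_discrete
  have := h'.integral_fun_mul_eq_mul_integral
    (hX.integrable_comp fun y => (y i : ℝ)).aestronglyMeasurable (by
      convert! (hX.integrable_comp fun y =>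
        u (∑ j ∈ Finset.univ.erase i, y j)).aestronglyMeasurable using 1
      ext ω
      simp)
  simpa using this

/-- Conditioning on the sum `Z` of the other indicators, both sides are `p (1 - p)` times the mean
of `g (Z + 1) - g Z`; the factor `1 - X i` keeps only the event where the whole sum is `Z`. -/
theorem integral_sub_mul_comp_sum (i : Fin n) (g : ℕ → ℝ) :
    ∫ ω, ((X i ω : ℝ) - ∫ ω, (X i ω : ℝ) ∂μ) * g (∑ j, X j ω) ∂μ =
      (∫ ω, (X i ω : ℝ) ∂μ) *
        ∫ ω, (1 - (X i ω : ℝ)) * (g (∑ j, X j ω + 1) - g (∑ j, X j ω)) ∂μ := by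
  set p := ∫ ω, (X i ω : ℝ) ∂μ
  set Z : Ω → ℕ := fun ω => ∑ j ∈ Finset.univ.erase i, X j ω with hZ
  have hsum : ∀ ω, ∑ j, X j ω = X i ω + Z ω := fun ω =>
    (Finset.add_sum_erase _ (fun j => X j ω) (Finset.mem_univ i)).symm
  have hI : ∀ u : ℕ → ℝ, ∫ ω, (X i ω : ℝ) * u (Z ω) ∂μ = p * ∫ ω, u (Z ω) ∂μ :=
    hX.integral_mul_comp_erase i
  have i0 : ∀ u : ℕ → ℝ, Integrable (fun ω => u (Z ω)) μ := fun u =>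
    hX.integrable_comp fun y => u (∑ j ∈ Finset.univ.erase i, y j)
  have i1 : ∀ u : ℕ → ℝ, Integrable (fun ω => (X i ω : ℝ) * u (Z ω)) μ := fun u =>
    hX.integrable_comp fun y => (y i : ℝ) * u (∑ j ∈ Finset.univ.erase i, y j)
  have e1 : ∀ ω, ((X i ω : ℝ) - p) * g (∑ j, X j ω) =
      (X i ω : ℝ) * ((1 - p) * g (Z ω + 1) + p * g (Z ω)) - p * g (Z ω) := by
    intro ω
    rw [hsum]
    rcases hX.zero_or_one i ω with h | h <;> simp [h, add_comm 1]
  have e2 : ∀ ω, (1 - (X i ω : ℝ)) * (g (∑ j, X j ω + 1) - g (∑ j, X j ω)) =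
      (g (Z ω + 1) - g (Z ω)) - (X i ω : ℝ) * (g (Z ω + 1) - g (Z ω)) := by
    intro ω
    rw [hsum]
    rcases hX.zero_or_one i ω with h | h <;> simp [h]
  simp_rw [e1, e2]
  rw [integral_sub (i1 fun a => (1 - p) * g (a + 1) + p * g a) (i0 fun a => p * g a),
    integral_sub (i0 fun a => g (a + 1) - g a) (i1 fun a => g (a + 1) - g a),
    hI fun a => (1 - p) * g (a + 1) + p * g a, hI fun a => g (a + 1) - g a,
    integral_add (i0 fun a => (1 - p) * g (a + 1)) (i0 fun a => p * g a),
    integral_sub (i0 fun a => g (a + 1)) (i0 g), integral_const_mul, integral_const_mul]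
  ring

theorem ae_eq_integral (i : Fin n)
    (hp : ∫ ω, (X i ω : ℝ) ∂μ = 0 ∨ ∫ ω, (X i ω : ℝ) ∂μ = 1) :
    ∀ᵐ ω ∂μ, (X i ω : ℝ) = ∫ ω, (X i ω : ℝ) ∂μ := by
  have hi : Integrable (fun ω => (X i ω : ℝ)) μ := hX.integrable_comp fun y => (y i : ℝ)
  rcases hp with hp | hp
  · rw [hp]
    exact (integral_eq_zero_iff_of_nonneg (fun ω => Nat.cast_nonneg _) hi).mp hp
  · rw [hp]
    have h : ∫ ω, (1 - (X i ω : ℝ)) ∂μ = 0 := by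
      rw [integral_sub (integrable_const _) hi, hp]
      simp
    have h' := (integral_eq_zero_iff_of_nonneg (fun ω => ?_) ((integrable_const _).sub hi)).mp h
    · filter_upwards [h'] with ω hω
      simp only [Pi.zero_apply, Pi.sub_apply] at hω
      linarith
    · rcases hX.zero_or_one i ω with h | h <;> simp [h]

variable {q : ℝ} (hq : ∀ i, ∫ ω, (X i ω : ℝ) ∂μ = q ∨ ∫ ω, (X i ω : ℝ) ∂μ = 0 ∨
  ∫ ω, (X i ω : ℝ) ∂μ = 1) {m v : ℝ} (hm : m = ∑ i, ∫ ω, (X i ω : ℝ) ∂μ)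
  (hv : v = ∑ i, (∫ ω, (X i ω : ℝ) ∂μ) * (1 - ∫ ω, (X i ω : ℝ) ∂μ))
include hq hm hv

/-- The Stein identity of a sum of independent indicators whose nondegenerate means agree. -/
theorem integral_sum_sub_mul (g : ℕ → ℝ) :
    ∫ ω, (((∑ i, X i ω : ℕ) : ℝ) - m) * g (∑ i, X i ω) ∂μ =
      ∫ ω, (v - q * (((∑ i, X i ω : ℕ) : ℝ) - m)) *
        (g (∑ i, X i ω + 1) - g (∑ i, X i ω)) ∂μ := by
  set p : Fin n → ℝ := fun i => ∫ ω, (X i ω : ℝ) ∂μ with hp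
  have h : ∀ i, ∫ ω, ((X i ω : ℝ) - p i) * g (∑ j, X j ω) ∂μ =
      ∫ ω, (p i * (1 - p i) - q * ((X i ω : ℝ) - p i)) *
        (g (∑ j, X j ω + 1) - g (∑ j, X j ω)) ∂μ := by
    intro i
    rw [hX.integral_sub_mul_comp_sum i g, ← integral_const_mul]
    refine integral_congr_ae ?_
    rcases hq i with h | h
    · refine .of_forall fun ω => ?_
      have h' : p i = q := h
      simp only [← h', hp]
      ring
    -- A degenerate indicator equals its mean almost surely, so the term carrying `q` vanishes and
    -- the coefficient `q` is harmless.
    · filter_upwards [hX.ae_eq_integral i h] with ω hω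
      have h' : p i = 0 ∨ p i = 1 := h
      have hω' : (X i ω : ℝ) = p i := hω
      change p i * _ = _
      rw [hω']
      rcases h' with h' | h' <;> rw [h'] <;> ring
  have e1 : ∀ ω, (((∑ i, X i ω : ℕ) : ℝ) - m) * g (∑ i, X i ω) =
      ∑ i, ((X i ω : ℝ) - p i) * g (∑ j, X j ω) := by
    intro ω
    rw [← Finset.sum_mul, Finset.sum_sub_distrib, hm]
    push_cast
    rfl
  have e2 : ∀ ω, (v - q * (((∑ i, X i ω : ℕ) : ℝ) - m)) *
        (g (∑ i, X i ω + 1) - g (∑ i, X i ω)) =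
      ∑ i, (p i * (1 - p i) - q * ((X i ω : ℝ) - p i)) *
        (g (∑ j, X j ω + 1) - g (∑ j, X j ω)) := by
    intro ω
    rw [← Finset.sum_mul, Finset.sum_sub_distrib, ← Finset.mul_sum, Finset.sum_sub_distrib, hm, hv]
    push_cast
    rfl
  simp_rw [e1, e2]
  rw [integral_finsetSum _ fun i _ => hX.integrable_comp fun y =>
      ((y i : ℝ) - p i) * g (∑ j, y j),
    integral_finsetSum _ fun i _ => hX.integrable_comp fun y =>
      (p i * (1 - p i) - q * ((y i : ℝ) - p i)) * (g (∑ j, y j + 1) - g (∑ j, y j))]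
  exact Finset.sum_congr rfl fun i _ => h i

/-- The Stein identity with `g = 1` gives the mean, and with `g` the identity it gives the variance.
-/
theorem integral_sum_sub_sq :
    ∫ ω, (((∑ i, X i ω : ℕ) : ℝ) - m) ^ 2 ∂μ = v := by
  have h1 := hX.integral_sum_sub_mul hq hm hv fun _ => 1
  have h2 := hX.integral_sum_sub_mul hq hm hv fun a => (a : ℝ)
  simp only [mul_one, sub_self, mul_zero, integral_zero] at h1
  have e : ∀ ω, (v - q * (((∑ i, X i ω : ℕ) : ℝ) - m)) *
      (((∑ i, X i ω + 1 : ℕ) : ℝ) - ((∑ i, X i ω : ℕ) : ℝ)) =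
      v - q * (((∑ i, X i ω : ℕ) : ℝ) - m) := by
    intro ω
    rw [Nat.cast_add_one]
    ring
  simp_rw [e] at h2
  rw [integral_sub (integrable_const _) (hX.integrable_comp_sum fun a => q * ((a : ℝ) - m)),
    integral_const_mul, h1] at h2
  have e' : ∀ ω, (((∑ i, X i ω : ℕ) : ℝ) - m) ^ 2 =
      (((∑ i, X i ω : ℕ) : ℝ) - m) * ((∑ i, X i ω : ℕ) : ℝ) -
        m * (((∑ i, X i ω : ℕ) : ℝ) - m) := by
    intro ω
    ring
  simp_rw [e']
  rw [integral_sub (hX.integrable_comp_sum fun a => ((a : ℝ) - m) * (a : ℝ))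
    (hX.integrable_comp_sum fun a => m * ((a : ℝ) - m)), integral_const_mul, h1, h2]
  simp

theorem integral_abs_sum_sub_le (hv0 : 0 < v) :
    ∫ ω, |((∑ i, X i ω : ℕ) : ℝ) - m| ∂μ ≤ √v := by
  have hs := Real.sqrt_pos.mpr hv0
  have h : ∫ ω, |((∑ i, X i ω : ℕ) : ℝ) - m| ∂μ ≤
      ∫ ω, ((((∑ i, X i ω : ℕ) : ℝ) - m) ^ 2 * (1 / (2 * √v)) + √v / 2) ∂μ := by
    refine integral_mono (hX.integrable_comp_sum fun a => |(a : ℝ) - m|)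
      (hX.integrable_comp_sum fun a => ((a : ℝ) - m) ^ 2 * (1 / (2 * √v)) + √v / 2) fun ω => ?_
    change |((∑ i, X i ω : ℕ) : ℝ) - m| ≤
      (((∑ i, X i ω : ℕ) : ℝ) - m) ^ 2 * (1 / (2 * √v)) + √v / 2
    rw [← sq_abs]
    generalize |((∑ i, X i ω : ℕ) : ℝ) - m| = z
    have : z ^ 2 * (1 / (2 * √v)) + √v / 2 - z = (z - √v) ^ 2 * (1 / (2 * √v)) := by
      field_simp
      ring
    have : 0 ≤ (z - √v) ^ 2 * (1 / (2 * √v)) := by positivity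
    linarith
  rw [integral_add (hX.integrable_comp_sum fun a => ((a : ℝ) - m) ^ 2 * (1 / (2 * √v)))
    (integrable_const _), integral_mul_const, hX.integral_sum_sub_sq hq hm hv] at h
  refine h.trans (le_of_eq ?_)
  have := Real.mul_self_sqrt hv0.le
  simp only [integral_const, probReal_univ, smul_eq_mul, one_mul]
  field_simp
  linarith

/-- Approximation by a translated Poisson law. -/
theorem abs_integral_sub_tsum_le (hq01 : q ∈ Set.Icc (0 : ℝ) 1) (hv0 : 0 < v) {s : ℕ} {lam : ℝ}
    (hs : lam = m - s) (hvl : v ≤ lam) (hlv : lam ≤ v + 1) {w : ℕ → ℝ}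
    (hw : IsPoissonWeight lam w) {F : ℕ → ℝ} (hF : ∀ a, F a ∈ Set.Icc (0 : ℝ) 1) :
    |∫ ω, F (∑ i, X i ω) ∂μ - ∑' j, w j * F (s + j)| ≤ 1 / √v + 3 / v := by
  have hl : 0 < lam := hw.mean_pos
  have hf : ∀ j, F (s + j) ∈ Set.Icc (0 : ℝ) 1 := fun j => hF _
  set h := steinSolution lam w fun j => F (s + j) with hh
  set c := ∑' j, w j * F (s + j) with hc
  have hc01 := hw.tsum_mem hf
  -- Truncated subtraction makes `g` constant up to `s`, so the increment bound also holds there.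
  set g : ℕ → ℝ := fun a => h (a - s) with hg
  have hΔ : ∀ a, |g (a + 1) - g a| ≤ 1 / lam := by
    intro a
    rcases lt_or_ge a s with ha | ha
    · have h1 : a + 1 - s = 0 := by omega
      have h2 : a - s = 0 := by omega
      simp only [hg, h1, h2, sub_self, abs_zero]
      positivity
    · have h1 : a + 1 - s = a - s + 1 := by omega
      simp only [hg, h1]
      exact hw.abs_steinSolution_sub_le hf _
  -- The defect of the shifted Stein equation: zero from `s` on, as `lam = m - s`. Below `s` the
  -- distance to `m` is at least `lam`, so a multiple of `(a - m)² / lam²` dominates it.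
  set R : ℕ → ℝ := fun a => F a - c - (lam * (g (a + 1) - g a) - ((a : ℝ) - m) * g a) with hR
  have hRle : ∀ a, |R a| ≤ 2 * (((a : ℝ) - m) ^ 2 / lam ^ 2) := by
    intro a
    rcases lt_or_ge a s with ha | ha
    · have h1 : a + 1 - s = 0 := by omega
      have h2 : a - s = 0 := by omega
      have h0 : |h 0| ≤ 1 / lam := hw.abs_steinSolution_one_le hf
      have e : R a = F a - c + ((a : ℝ) - m) * h 0 := by
        simp only [hR, hg, h1, h2]
        ring
      have hma : lam ≤ m - a := by
        have : (a : ℝ) ≤ s := by exact_mod_cast ha.le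
        linarith
      have hr : 1 ≤ (m - a) / lam := (one_le_div hl).mpr hma
      have h3 : |F a - c| ≤ 1 := by
        rw [abs_le]
        constructor <;> linarith [(hF a).1, (hF a).2, hc01.1, hc01.2]
      have h4 : |((a : ℝ) - m) * h 0| ≤ (m - a) / lam := by
        rw [abs_mul, abs_sub_comm, abs_of_nonneg (by linarith : 0 ≤ m - a)]
        calc (m - a) * |h 0| ≤ (m - a) * (1 / lam) :=
              mul_le_mul_of_nonneg_left h0 (by linarith)
          _ = (m - a) / lam := by ring
      have h5 : ((a : ℝ) - m) ^ 2 / lam ^ 2 = ((m - a) / lam) ^ 2 := by ring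
      rw [e, h5]
      have := abs_add_le (F a - c) (((a : ℝ) - m) * h 0)
      nlinarith
    · have h1 : a + 1 - s = a - s + 1 := by omega
      have h2 := hw.steinSolution_eq (fun j => F (s + j)) (a - s)
      rw [Nat.cast_sub ha, Nat.add_sub_cancel' ha] at h2
      have e : R a = 0 := by
        simp only [hR, hg, h1]
        rw [← hh, ← hc] at h2
        rw [← h2, hs]
        ring
      rw [e, abs_zero]
      positivity
  -- What is left after the Stein identity trades `(a - m) * g a` for `(v - q * (a - m))` times the
  -- increment of `g`.
  set H : ℕ → ℝ := fun a => (lam - v + q * ((a : ℝ) - m)) * (g (a + 1) - g a) + R a with hH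
  have hHle : ∀ a, |H a| ≤ (1 + |(a : ℝ) - m|) * (1 / lam) +
      2 * (((a : ℝ) - m) ^ 2 / lam ^ 2) := by
    intro a
    refine (abs_add_le _ _).trans (add_le_add ?_ (hRle a))
    rw [abs_mul]
    refine mul_le_mul ?_ (hΔ a) (abs_nonneg _) (by positivity)
    refine (abs_add_le _ _).trans (add_le_add ?_ ?_)
    · rw [abs_le]
      constructor <;> linarith
    · rw [abs_mul, abs_of_nonneg hq01.1]
      exact mul_le_of_le_one_left (abs_nonneg _) hq01.2
  have hint : ∫ ω, F (∑ i, X i ω) ∂μ - c = ∫ ω, H (∑ i, X i ω) ∂μ := by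
    have e : ∀ ω, F (∑ i, X i ω) = c + (H (∑ i, X i ω) +
        (v - q * (((∑ i, X i ω : ℕ) : ℝ) - m)) * (g (∑ i, X i ω + 1) - g (∑ i, X i ω)) -
        (((∑ i, X i ω : ℕ) : ℝ) - m) * g (∑ i, X i ω)) := by
      intro ω
      simp only [hH, hR]
      ring
    have I := hX.integrable_comp_sum
    have e2 := hX.integral_sum_sub_mul hq hm hv g
    simp_rw [e]
    rw [integral_add (integrable_const _) (I fun a => H a +
        (v - q * ((a : ℝ) - m)) * (g (a + 1) - g a) - ((a : ℝ) - m) * g a),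
      integral_sub (I fun a => H a + (v - q * ((a : ℝ) - m)) * (g (a + 1) - g a))
        (I fun a => ((a : ℝ) - m) * g a),
      integral_add (I H) (I fun a => (v - q * ((a : ℝ) - m)) * (g (a + 1) - g a)), e2]
    simp
  rw [hint]
  have I := hX.integrable_comp_sum
  have hb : ∫ ω, |H (∑ i, X i ω)| ∂μ ≤ ∫ ω, ((1 + |((∑ i, X i ω : ℕ) : ℝ) - m|) * (1 / lam) +
      2 * ((((∑ i, X i ω : ℕ) : ℝ) - m) ^ 2 / lam ^ 2)) ∂μ :=
    integral_mono (I fun a => |H a|) (I fun a => (1 + |(a : ℝ) - m|) * (1 / lam) +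
      2 * (((a : ℝ) - m) ^ 2 / lam ^ 2)) fun ω => hHle _
  rw [integral_add (I fun a => (1 + |(a : ℝ) - m|) * (1 / lam))
      (I fun a => 2 * (((a : ℝ) - m) ^ 2 / lam ^ 2)),
    integral_mul_const, integral_const_mul, integral_div, hX.integral_sum_sub_sq hq hm hv,
    integral_add (integrable_const _) (I fun a => |(a : ℝ) - m|)] at hb
  simp only [integral_const, probReal_univ, smul_eq_mul, one_mul] at hb
  refine (abs_integral_le_integral_abs.trans hb).trans ?_
  have h1 := hX.integral_abs_sum_sub_le hq hm hv hv0
  have hsv := Real.sqrt_pos.mpr hv0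
  calc (1 + ∫ ω, |((∑ i, X i ω : ℕ) : ℝ) - m| ∂μ) * (1 / lam) + 2 * (v / lam ^ 2)
      ≤ (1 + √v) * (1 / v) + 2 * (v / v ^ 2) := by gcongr
    _ = 1 / √v + 3 / v := by
      have := Real.mul_self_sqrt hv0.le
      field_simp
      linarith

end IndependentIndicators

/-! ### Translated Poisson laws -/

/-- The law of `s + N`, where `N` has the Poisson law with mean `r`. -/
noncomputable def translatedPoisson (s : ℕ) (r : NNReal) : Measure ℕ :=
  (poissonMeasure r).map fun j => s + j

instance (s : ℕ) (r : NNReal) : IsProbabilityMeasure (translatedPoisson s r) :=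
  Measure.isProbabilityMeasure_map .of_discrete

theorem translatedPoisson_real (s : ℕ) (r : NNReal) (A : Set ℕ) :
    (translatedPoisson s r).real A =
      ∑' j, (poissonMeasure r).real {j} * A.indicator (fun _ => (1 : ℝ)) (s + j) := by
  rw [translatedPoisson, map_measureReal_apply .of_discrete .of_discrete,
    ← (hasSum_indicator_real_singleton (poissonMeasure r) _).tsum_eq]
  refine tsum_congr fun j => ?_
  by_cases h : s + j ∈ A <;> simp [h]

theorem translatedPoisson_real_singleton_of_lt {s a : ℕ} (r : NNReal) (h : a < s) :
    (translatedPoisson s r).real {a} = 0 := by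
  rw [translatedPoisson, map_measureReal_apply .of_discrete .of_discrete]
  have : (fun j => s + j) ⁻¹' {a} = (∅ : Set ℕ) := by
    ext j
    simp only [Set.mem_preimage, Set.mem_singleton_iff, Set.mem_empty_iff_false, iff_false]
    omega
  simp [this]

theorem translatedPoisson_real_singleton_add (s j : ℕ) (r : NNReal) :
    (translatedPoisson s r).real {s + j} = (poissonMeasure r).real {j} := by
  rw [translatedPoisson, map_measureReal_apply .of_discrete .of_discrete]
  congr 1
  ext i
  simp

theorem translatedPoisson_succ {s a : ℕ} {r : NNReal} (hr : 0 < r) (h : s ≤ a) :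
    ((a : ℝ) + 1 - s) * (translatedPoisson s r).real {a + 1} =
      r * (translatedPoisson s r).real {a} := by
  obtain ⟨j, rfl⟩ := Nat.exists_eq_add_of_le h
  rw [add_assoc, translatedPoisson_real_singleton_add, translatedPoisson_real_singleton_add,
    ← (isPoissonWeight_poissonMeasure hr).succ j]
  push_cast
  ring

/-- From `s` on, the likelihood ratio `p / p'` is multiplied at each step by `r (a + 1 - t) / (u (a
+ 1 - s))`, which is nonincreasing in `a` because `t ≤ s`. Hence the ratio is unimodal; below `s`,
`p` vanishes. -/
theorem translatedPoisson_ordConnected_setOf_lt {s t : ℕ} {r u : NNReal} (hr : 0 < r)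
    (hu : 0 < u) (hts : t ≤ s) :
    {a | (translatedPoisson t u).real {a} < (translatedPoisson s r).real {a}}.OrdConnected := by
  set p : ℕ → ℝ := fun a => (translatedPoisson s r).real {a}
  set p' : ℕ → ℝ := fun a => (translatedPoisson t u).real {a}
  have hp' : ∀ a, 0 ≤ p' a := fun a => measureReal_nonneg
  have hp0 : ∀ a, 0 ≤ p a := fun a => measureReal_nonneg
  have hts' : (t : ℝ) ≤ s := by exact_mod_cast hts
  have hsa : ∀ a, p' a < p a → s ≤ a := by
    intro a ha
    by_contra h
    have h0 : p a = 0 := translatedPoisson_real_singleton_of_lt r (not_le.mp h)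
    linarith [hp' a]
  have hr' : (0 : ℝ) < r := by exact_mod_cast hr
  have hu' : (0 : ℝ) < u := by exact_mod_cast hu
  -- once the difference becomes nonpositive it stays so
  have step : ∀ x, p' x < p x → p (x + 1) ≤ p' (x + 1) → ∀ y, x + 1 ≤ y → p y ≤ p' y := by
    intro x hx hx1 y hy
    have hsx := hsa x hx
    have hsx' : (s : ℝ) ≤ x := by exact_mod_cast hsx
    have e1 : ((x : ℝ) + 1 - s) * p (x + 1) = r * p x := translatedPoisson_succ hr hsx
    have e2 : ((x : ℝ) + 1 - t) * p' (x + 1) = u * p' x :=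
      translatedPoisson_succ hu (hts.trans hsx)
    have hxs : (0 : ℝ) < x + 1 - s := by linarith
    have hxt : (0 : ℝ) < x + 1 - t := by linarith
    have hpx : 0 < p x := (hp' x).trans_lt hx
    -- A crossing from above forces the step factor to be at most `1`; `c2` and `c3` propagate this
    -- to all later steps.
    have c1 : r * ((x : ℝ) + 1 - t) ≤ u * ((x : ℝ) + 1 - s) := by
      have h1 : r * p x * ((x : ℝ) + 1 - t) ≤ u * p x * ((x : ℝ) + 1 - s) := by
        calc r * p x * ((x : ℝ) + 1 - t)
            = ((x : ℝ) + 1 - s) * ((x : ℝ) + 1 - t) * p (x + 1) := by rw [← e1]; ring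
          _ ≤ ((x : ℝ) + 1 - s) * ((x : ℝ) + 1 - t) * p' (x + 1) := by gcongr
          _ = u * p' x * ((x : ℝ) + 1 - s) := by rw [← e2]; ring
          _ ≤ u * p x * ((x : ℝ) + 1 - s) := by gcongr
      nlinarith
    have c2 : (r : ℝ) ≤ u := by
      have : r * ((x : ℝ) + 1 - s) ≤ u * ((x : ℝ) + 1 - s) :=
        (mul_le_mul_of_nonneg_left (by linarith) hr'.le).trans c1
      exact le_of_mul_le_mul_right this hxs
    induction y, hy using Nat.le_induction with
    | base => exact hx1
    | succ y hy ih =>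
      have hxy : (x : ℝ) ≤ y := by exact_mod_cast (Nat.le_succ x).trans hy
      have f1 : ((y : ℝ) + 1 - s) * p (y + 1) = r * p y :=
        translatedPoisson_succ hr (by omega)
      have f2 : ((y : ℝ) + 1 - t) * p' (y + 1) = u * p' y :=
        translatedPoisson_succ hu (by omega)
      have hys : (0 : ℝ) < y + 1 - s := by linarith
      have hyt : (0 : ℝ) < y + 1 - t := by linarith
      have c3 : r * ((y : ℝ) + 1 - t) ≤ u * ((y : ℝ) + 1 - s) := by
        nlinarith [mul_le_mul_of_nonneg_right c2 (sub_nonneg.mpr hxy)]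
      have : ((y : ℝ) + 1 - s) * ((y : ℝ) + 1 - t) * p (y + 1) ≤
          ((y : ℝ) + 1 - s) * ((y : ℝ) + 1 - t) * p' (y + 1) := by
        calc ((y : ℝ) + 1 - s) * ((y : ℝ) + 1 - t) * p (y + 1)
            = r * ((y : ℝ) + 1 - t) * p y := by linear_combination ((y : ℝ) + 1 - t) * f1
          _ ≤ u * ((y : ℝ) + 1 - s) * p y := mul_le_mul_of_nonneg_right c3 (hp0 y)
          _ ≤ u * ((y : ℝ) + 1 - s) * p' y := by gcongr
          _ = _ := by linear_combination -((y : ℝ) + 1 - s) * f2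
      exact le_of_mul_le_mul_left this (by positivity)
  refine ⟨fun a ha c hc b hb => ?_⟩
  by_contra hbn
  have key : ∀ b, a ≤ b → p b ≤ p' b → ∀ y, b ≤ y → p y ≤ p' y := by
    intro b hab
    induction b, hab using Nat.le_induction with
    | base => exact fun h => absurd ha (not_lt.mpr h)
    | succ b hab ih =>
      intro h y hy
      rcases lt_or_ge (p' b) (p b) with h' | h'
      · exact step b h' h y hy
      · exact ih h' y (by omega)
  exact absurd hc (not_lt.mpr (key b hb.1 (not_lt.mp hbn) c hb.2))

/-! ### Comparison of two laws close to translated Poisson laws -/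

/-- Replacing both laws by their approximations on `A` costs `2 * d`, and returning on the interval
`B` costs `2 * d` again. If the shifts are ordered the other way, the argument runs on `Aᶜ` with the
roles exchanged. -/
theorem tvDist_le_of_close_translatedPoisson (P Q : Measure ℕ) [IsProbabilityMeasure P]
    [IsProbabilityMeasure Q] {s t : ℕ} {r u : NNReal} (hr : 0 < r) (hu : 0 < u) {d : ℝ}
    (hP : ∀ A, |P.real A - (translatedPoisson s r).real A| ≤ d)
    (hQ : ∀ A, |Q.real A - (translatedPoisson t u).real A| ≤ d) :
    tvDist P Q ≤ 2 * natKolmogorovDist P Q + 4 * d := by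
  have hP1 := fun A => abs_le.mp (hP A)
  have hQ1 := fun A => abs_le.mp (hQ A)
  rw [tvDist_eq_real_sub]
  set A := {a : ℕ | Q.real {a} < P.real {a}}
  rcases le_total t s with h | h
  · have hB := translatedPoisson_ordConnected_setOf_lt hr hu h
    have h1 := real_sub_le_real_sub_setOf_lt (translatedPoisson s r) (translatedPoisson t u) A
    set B := {a | (translatedPoisson t u).real {a} < (translatedPoisson s r).real {a}}
    have h2 := abs_le.mp (abs_real_sub_le_of_ordConnected P Q hB)
    linarith [hP1 A, hP1 B, hQ1 A, hQ1 B]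
  · have hB := translatedPoisson_ordConnected_setOf_lt hu hr h
    have h1 := real_sub_le_real_sub_setOf_lt (translatedPoisson t u) (translatedPoisson s r) Aᶜ
    set B := {a | (translatedPoisson s r).real {a} < (translatedPoisson t u).real {a}}
    have h2 := abs_le.mp (abs_real_sub_le_of_ordConnected P Q hB)
    have hPc := probReal_compl_eq_one_sub (μ := P) (s := A) .of_discrete
    have hQc := probReal_compl_eq_one_sub (μ := Q) (s := A) .of_discrete
    linarith [hP1 Aᶜ, hP1 B, hQ1 Aᶜ, hQ1 B]

/-! ### Collections in heavy Binomial form -/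

theorem exists_translatedPoisson_close {Ω : Type*} [MeasurableSpace Ω] {μ : Measure Ω}
    [IsProbabilityMeasure μ] {n : ℕ} {X : Fin n → Ω → ℕ} (hX : IndependentIndicators μ X)
    {q : ℝ} (hq01 : q ∈ Set.Icc (0 : ℝ) 1)
    (hq : ∀ i, ∫ ω, (X i ω : ℝ) ∂μ = q ∨ ∫ ω, (X i ω : ℝ) ∂μ = 0 ∨ ∫ ω, (X i ω : ℝ) ∂μ = 1)
    {v : ℝ} (hv : v = ∑ i, (∫ ω, (X i ω : ℝ) ∂μ) * (1 - ∫ ω, (X i ω : ℝ) ∂μ)) (hv0 : 0 < v) :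
    ∃ (s : ℕ) (r : NNReal), 0 < r ∧ ∀ A,
      |(μ.map fun ω => ∑ i, X i ω).real A - (translatedPoisson s r).real A| ≤
        1 / √v + 3 / v := by
  set m := ∑ i, ∫ ω, (X i ω : ℝ) ∂μ with hm
  -- Here `m - v` is the sum of the squared means, so its floor is a legitimate shift.
  have hmv : 0 ≤ m - v := by
    rw [hm, hv, ← Finset.sum_sub_distrib]
    exact Finset.sum_nonneg fun i _ => by
      linarith [sq_nonneg (∫ ω, (X i ω : ℝ) ∂μ)]
  have h1 := Nat.floor_le hmv
  have h2 := Nat.lt_floor_add_one (m - v)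
  set s := ⌊m - v⌋₊
  have hl : 0 < m - s := by linarith
  obtain ⟨r, hr⟩ : ∃ r : NNReal, (r : ℝ) = m - s := ⟨⟨m - s, hl.le⟩, rfl⟩
  have hr0 : 0 < r := by exact_mod_cast hr ▸ hl
  refine ⟨s, r, hr0, fun A => ?_⟩
  have h := hX.abs_integral_sub_tsum_le hq hm hv hq01 hv0 hr (by linarith) (by linarith)
    (isPoissonWeight_poissonMeasure hr0)
    (F := A.indicator fun _ => (1 : ℝ)) fun a => by
      by_cases ha : a ∈ A <;> simp [ha]
  rw [← translatedPoisson_real] at h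
  convert! h using 3
  rw [map_measureReal_apply hX.measurable_sum .of_discrete,
    ← integral_indicator_one (hX.measurable_sum .of_discrete)]
  rfl

theorem HeavyBinomialCollection.exists_translatedPoisson_close {Ω : Type*} [MeasurableSpace Ω]
    {μ : Measure Ω} [IsProbabilityMeasure μ] {k n : ℕ} {X : Fin n → Ω → ℕ}
    (hX : HeavyBinomialCollection μ k X) (hk : 3 ≤ k) :
    ∃ (s : ℕ) (r : NNReal), 0 < r ∧ ∀ A,
      |(μ.map fun ω => ∑ i, X i ω).real A - (translatedPoisson s r).real A| ≤ 6 / k := by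
  obtain ⟨ℓ, q, hℓ, ⟨j, -, hj, rfl⟩, hlt, hge, -, hvar⟩ := hX.heavy
  beta_reduce at hlt hge
  set q : ℝ := (j : ℝ) / (k * n)
  have hq01 : q ∈ Set.Icc (0 : ℝ) 1 := by
    refine ⟨by positivity, div_le_one_of_le₀ ?_ (by positivity)⟩
    exact_mod_cast hj.le
  have hsum : ℓ * q * (1 - q) =
      ∑ i, (∫ ω, (X i ω : ℝ) ∂μ) * (1 - ∫ ω, (X i ω : ℝ) ∂μ) := by
    have h : ∀ i : Fin n, (∫ ω, (X i ω : ℝ) ∂μ) * (1 - ∫ ω, (X i ω : ℝ) ∂μ) =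
        if (i : ℕ) < ℓ then q * (1 - q) else 0 := by
      intro i
      split_ifs with hi
      · simp only [hlt i hi]
      · rcases hge i (not_lt.mp hi) with h | h <;> simp [h]
    rw [Finset.sum_congr rfl fun i _ => h i, Fin.sum_univ_eq_sum_range
      (fun i => if i < ℓ then q * (1 - q) else 0), ← Finset.sum_filter, Finset.sum_const]
    have : (Finset.range n).filter (· < ℓ) = Finset.range ℓ := by
      ext i
      simp only [Finset.mem_filter, Finset.mem_range]
      omega
    rw [this, Finset.card_range, nsmul_eq_mul, mul_assoc]
  have hk' : (3 : ℝ) ≤ k := by exact_mod_cast hk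
  have hk0 : (0 : ℝ) < k := by linarith
  -- For `k ≥ 3` the variance hypothesis gives at least `k² - k - 2 ≥ k² / 4`.
  have hv : (k / 2 : ℝ) ^ 2 ≤ ℓ * q * (1 - q) := by
    have : 3 / (k : ℝ) ≤ 1 := div_le_one_of_le₀ hk' hk0.le
    nlinarith
  have hv0 : 0 < ℓ * q * (1 - q) := lt_of_lt_of_le (by positivity) hv
  obtain ⟨s, r, hr, h⟩ := PoissonBinomial.exists_translatedPoisson_close hX.indicators hq01
    (fun i => (lt_or_ge (i : ℕ) ℓ).imp (hlt i) (hge i)) hsum hv0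
  refine ⟨s, r, hr, fun A => (h A).trans ?_⟩
  have hs : k / 2 ≤ √(ℓ * q * (1 - q)) := Real.le_sqrt_of_sq_le hv
  calc 1 / √(ℓ * q * (1 - q)) + 3 / (ℓ * q * (1 - q)) ≤ 1 / (k / 2) + 3 / (k / 2 : ℝ) ^ 2 := by
        gcongr
    _ = 2 / k + 12 / k * (1 / k) := by
        field_simp
        ring
    _ ≤ 2 / k + 12 / k * (1 / 3) := by gcongr
    _ = 6 / k := by ring

theorem dK_eq_natKolmogorovDist {Ω Ω' : Type*} [MeasurableSpace Ω] [MeasurableSpace Ω']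
    (μ : Measure Ω) (ν : Measure Ω') {X : Ω → ℕ} {Y : Ω' → ℕ} (hX : Measurable X)
    (hY : Measurable Y) : dK μ X ν Y = natKolmogorovDist (μ.map X) (ν.map Y) := by
  rw [natKolmogorovDist, Measure.map_map .of_discrete hX, Measure.map_map .of_discrete hY]
  rfl

end PoissonBinomial

theorem mainTheorem9 :
    ∃ C : ℝ, 0 < C ∧
      ∀ (k n : ℕ), 1 ≤ k →
      ∀ (Ω : Type*) [MeasurableSpace Ω] (μ : Measure Ω) [IsProbabilityMeasure μ]
        (Ω' : Type*) [MeasurableSpace Ω'] (ν : Measure Ω') [IsProbabilityMeasure ν]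
        (X : Fin n → Ω → ℕ) (Y : Fin n → Ω' → ℕ),
        PoissonBinomial.HeavyBinomialCollection μ k X →
        PoissonBinomial.HeavyBinomialCollection ν k Y →
        (1 / 2 : ℝ) * PoissonBinomial.dK μ (fun ω => ∑ i, X i ω) ν (fun ω => ∑ i, Y i ω) ≤
            PoissonBinomial.dTV μ (fun ω => ∑ i, X i ω) ν (fun ω => ∑ i, Y i ω) ∧
          PoissonBinomial.dTV μ (fun ω => ∑ i, X i ω) ν (fun ω => ∑ i, Y i ω) ≤
            2 * PoissonBinomial.dK μ (fun ω => ∑ i, X i ω) ν (fun ω => ∑ i, Y i ω) +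
              C / (k : ℝ) := by
  -- `24 = 4 * 6`: four approximation errors of `6 / k`. For `k < 3` the term `24 / k` exceeds `1`,
  -- which bounds any total variation distance.
  refine ⟨24, by norm_num, fun k n hk Ω _ μ _ Ω' _ ν _ X Y hX hY => ?_⟩
  have mX := hX.indicators.measurable_sum
  have mY := hY.indicators.measurable_sum
  have := Measure.isProbabilityMeasure_map (μ := μ) mX.aemeasurable
  have := Measure.isProbabilityMeasure_map (μ := ν) mY.aemeasurable
  rw [PoissonBinomial.dK_eq_natKolmogorovDist μ ν mX mY, PoissonBinomial.dTV]
  refine ⟨PoissonBinomial.half_natKolmogorovDist_le_tvDist _ _, ?_⟩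
  rcases le_or_gt 3 k with h | h
  · obtain ⟨s, r, hr, hP⟩ := hX.exists_translatedPoisson_close h
    obtain ⟨t, u, hu, hQ⟩ := hY.exists_translatedPoisson_close h
    refine (PoissonBinomial.tvDist_le_of_close_translatedPoisson _ _ hr hu hP hQ).trans
      (le_of_eq ?_)
    ring
  · have hk0 : (0 : ℝ) < k := by exact_mod_cast hk
    have hk3 : (k : ℝ) < 3 := by exact_mod_cast h
    have h1 : (1 : ℝ) ≤ 24 / k := by
      rw [le_div_iff₀ hk0]
      linarith
    linarith [PoissonBinomial.tvDist_le_one (μ.map fun ω => ∑ i, X i ω)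
        (ν.map fun ω => ∑ i, Y i ω),
      PoissonBinomial.natKolmogorovDist_nonneg (μ.map fun ω => ∑ i, X i ω)
        (ν.map fun ω => ∑ i, Y i ω)]
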